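/- Let $G_0$ be a finite connected graph (loops and multiple edges are allowed; a loop adds $2$ to the degree) with $\tau_0\ge 2$ vertices, one of which is designated as the hook. Let $d_1<\dots<d_k$ be the distinct degrees of the vertices of $G_0$, let $n_j\ge 1$ be the number of vertices of $G_0$ of degree $d_j$, and let $h=d_i$ be the degree of the hook. In the unary hooking network grown from the seed $G_0$, each node has one insertion position, which is used up when the node serves as a latch. The network at age $0$ is $G_0$. At each step $n\ge1$, one of the insertion positions of the network at age $n-1$ is chosen uniformly at random, independently of the past given the network, and the hook of a new copy of $G_0$ is fused with the node (the latch) that carries this position; the fused node has no insertion position left, and every other node of the new copy has one. Let $\mathbf A$ be the $k\times k$ matrix with entries $a_{j,\ell}=n_\ell-\mathbf 1[\ell=i]-\mathbf 1[\ell=j]$ (the replacement matrix of the associated Pólya urn, in which the balls of color $j$ are the insertion positions at nodes originally of degree $d_j$). Call the network nondegenerate if no component of the principal eigenvector of $\mathbf A^T$ (an eigenvector for the eigenvalue with the largest real part) is $0$. For $j\in\{1,\dots,k\}$ and $s\in\{0,1\}$, let $D_{n,d_j+sh}$ be the number of nodes in the network at age $n$ that are originally (when they appear) of degree $d_j$ and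 have been latches $s$ times; counts with different $(j,s)$ are kept separate even if the numbers $d_j+sh$ coincide. If the network is nondegenerate, then, almost surely, as $n\to\infty$, $$\frac1n\big(D_{n,d_1},\dots,D_{n,d_k},D_{n,d_1+h},\dots,D_{n,d_k+h}\big)\longrightarrow \frac1{\tau_0-1}\big((\tau_0-2)\,\mathbf n',\ \mathbf n'\big),\qquad \mathbf n'=(n_1,\dots,n_{i-1},n_i-1,n_{i+1},\dots,n_k).$$ -/

import Mathlib

open Filter Topology MeasureTheory
open scoped Graph

noncomputable section

namespace HookingNetwork

variable {V E : Type*}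

/-- The degree of a vertex in a multigraph: a loop contributes two, any other edge at the vertex
contributes one. -/
def degree {α β : Type*} (G : Graph α β) (x : α) : ℕ :=
  (G.incidenceSet x).ncard + (G.loopSet x).ncard

/-- A multigraph is connected if it has a vertex and any two of its vertices are joined by a
path. -/
def Connected {α β : Type*} (G : Graph α β) : Prop :=
  V(G).Nonempty ∧ ∀ x ∈ V(G), ∀ y ∈ V(G), Relation.ReflTransGen G.Adj x y

open Classical in
/-- Where a vertex of the seed goes when a copy of the seed is hooked. The seed itself is copy `0`,
and its vertex `v` is the node `(0, v)`. In copy `t + 1`, the hook is fused with the latch `q t`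
chosen at step `t + 1`, and any other vertex `v` becomes a new node `(t + 1, v)`. -/
def place (hook : V) (q : ℕ → ℕ × V) : ℕ → V → ℕ × V
  | 0, v => (0, v)
  | t + 1, v => if v = hook then q t else (t + 1, v)

/-- The network at age `n` grown from the seed `S` when the latches `q 0, q 1, …, q (n - 1)` are
chosen at the steps `1, 2, …, n`: the union of the copies `0, …, n` of the seed, in which the hook
of each copy `t + 1` is fused with `q t`. The edge `e` of copy `t` is labelled `(t, e)`. -/
def network (S : Graph V E) (hook : V) (q : ℕ → ℕ × V) (n : ℕ) : Graph (ℕ × V) (ℕ × E) where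
  vertexSet := {x | ∃ t ≤ n, ∃ v ∈ V(S), x = place hook q t v}
  IsLink e x y := e.1 ≤ n ∧ ∃ u v, S.IsLink e.2 u v ∧
    x = place hook q e.1 u ∧ y = place hook q e.1 v
  isLink_symm := by
    intro e _
    constructor
    rintro x y ⟨hn, u, v, h, hx, hy⟩
    exact ⟨hn, v, u, h.symm, hy, hx⟩
  eq_or_eq_of_isLink_of_isLink := by
    rintro e x y z w ⟨_, u, v, h, rfl, rfl⟩ ⟨_, u', v', h', rfl, rfl⟩
    rcases h.left_eq_or_eq h' with rfl | rfl
    · exact Or.inl rfl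
    · exact Or.inr rfl
  left_mem_of_isLink := by
    rintro e x y ⟨hn, u, v, h, rfl, rfl⟩
    exact ⟨e.1, hn, u, h.left_mem, rfl⟩

/-- The number of times that the node `x` has been the latch by age `n`. -/
def latchCount (q : ℕ → ℕ × V) (n : ℕ) (x : ℕ × V) : ℕ :=
  {t : ℕ | t < n ∧ q t = x}.ncard

/-- The insertion positions (virtual nodes) of the `m`-ary network at age `n`: a node that has
recruited `r` times carries `m - r` of them. A position is written as `(x, c)`, where `x` is the
node to which it is attached and `c` is its index at that node. -/
def insertionPositions (S : Graph V E) (hook : V) (m : ℕ) (q : ℕ → ℕ × V) (n : ℕ) :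
    Set ((ℕ × V) × ℕ) :=
  {p | p.1 ∈ V(network S hook q n) ∧ p.2 < m - latchCount q n p.1}

/-- The random latches `L 0, L 1, …`, defined on a probability space, grow an `m`-ary hooking network
under the uniform model: given the choices at the steps `1, …, n`, one of the insertion positions
of the network at age `n` is chosen, all of them being equally likely, and `L n` is the node to
which the chosen position is attached. -/
structure IsUniformHooking (S : Graph V E) (hook : V) (m : ℕ) {Ω : Type*} [MeasurableSpace Ω]
    (P : Measure Ω) (L : ℕ → Ω → ℕ × V) : Prop where
  measurable : ∀ n x, MeasurableSet {ω | L n ω = x}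
  uniform : ∀ (n : ℕ) (q : ℕ → ℕ × V) (x : ℕ × V),
    P {ω | ∀ t < n, L t ω = q t} ≠ 0 →
      ProbabilityTheory.cond P {ω | ∀ t < n, L t ω = q t} {ω | L n ω = x} =
        ({p ∈ insertionPositions S hook m q n | p.1 = x}.ncard : ENNReal) /
          ((insertionPositions S hook m q n).ncard : ENNReal)

/-- The original degree of a node `x = (t, v)`: its degree in the network at age `t`, at which the
node appears. -/
def originalDegree (S : Graph V E) (hook : V) (q : ℕ → ℕ × V) (x : ℕ × V) : ℕ :=
  degree (network S hook q x.1) x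

/-- The number of nodes in the network at age `n` that are originally of degree `δ` and have
experienced latching `s` times. -/
def nodeCount (S : Graph V E) (hook : V) (q : ℕ → ℕ × V) (n δ s : ℕ) : ℕ :=
  {x ∈ V(network S hook q n) | originalDegree S hook q x = δ ∧ latchCount q n x = s}.ncard

/-- The number of vertices of degree `δ` in the seed. -/
def seedCount (S : Graph V E) (δ : ℕ) : ℕ :=
  {v ∈ V(S) | degree S v = δ}.ncard

/-- The replacement matrix of the Pólya urn of the insertion positions of an `m`-ary network, for a
seed with `N j` vertices of the `j`-th degree and a hook of the `i`-th degree. The colour `(s, j)` is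
that of the positions at nodes originally of the `j`-th degree which have recruited `s` times.
When a position of colour `(s, j)` is drawn, the hooked copy brings `m` positions of colour `(0, l)`
for each of its vertices of the `l`-th degree other than the hook, and the `m - s` positions of
colour `(s, j)` at the latch are replaced by `m - s - 1` positions of colour `(s + 1, j)`. -/
def replacementMatrix (m : ℕ) {k : ℕ} (N : Fin k → ℕ) (i : Fin k) :
    Matrix (Fin m × Fin k) (Fin m × Fin k) ℤ :=
  Matrix.of fun a b =>
    (if (b.1 : ℕ) = 0 then (m : ℤ) * ((N b.2 : ℤ) - if b.2 = i then 1 else 0) else 0)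
      - (if b = a then (m : ℤ) - (a.1 : ℕ) else 0)
      + (if (b.1 : ℕ) = (a.1 : ℕ) + 1 ∧ b.2 = a.2 then (m : ℤ) - (a.1 : ℕ) - 1 else 0)

/-- `v` is a principal eigenvector of the complex matrix `M`: an eigenvector for an eigenvalue with
the largest real part, scaled so that `‖v‖₁ = 1`. -/
def IsPrincipalEigenvector {ι : Type*} [Fintype ι] [DecidableEq ι] (M : Matrix ι ι ℂ)
    (v : ι → ℂ) : Prop :=
  ∑ c, ‖v c‖ = 1 ∧
    ∃ μ : ℂ, M.mulVec v = μ • v ∧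
      ∀ ν : ℂ, Module.End.HasEigenvalue (Matrix.toLin' M) ν → ν.re ≤ μ.re

/-- The network is nondegenerate if no component of the principal eigenvector of the transposed
replacement matrix vanishes. -/
def Nondegenerate (m : ℕ) {k : ℕ} (N : Fin k → ℕ) (i : Fin k) : Prop :=
  ∀ v : Fin m × Fin k → ℂ,
    IsPrincipalEigenvector ((replacementMatrix m N i).map (Int.cast : ℤ → ℂ)).transpose v →
      ∀ c, v c ≠ 0

end HookingNetwork

end

/-!
Fix a set `U` of seed vertices, and let `b` be the number of vertices of `U` other than the hook
divided by `τ₀ - 1`. Each step adds `b (τ₀ - 1)` free positions at copies of vertices in `U`, and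
removes one if the latch is such a copy. Hence the number of free positions at copies of `U` exceeds
`b` times the number `T n` of all free positions by `W n = W 0 + n b - N n`, where `N n` counts the
latches in `U`, and the next latch is in `U` with conditional probability `b + W n / T n`. So a step
contracts `W` in mean, and only adds a bounded variance: `E (W n)² = O(n)`. Summing
`E (W (n²) / n²)²` gives `W (n²) / n² → 0` almost surely, and since `N` is monotone, `N n / n → b`.

A node appears with the degree that its vertex has in the seed, and it is a latch at most once; with
`U` the set of vertices of degree `δ`, both counts of nodes of degree `δ` are determined by `N`.
-/

section StrongLaw

open scoped ProbabilityTheory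

variable {Ω : Type*} {mΩ : MeasurableSpace Ω} {P : Measure Ω}

theorem ae_tendsto_zero_of_summable_integral_sq {f : ℕ → Ω → ℝ}
    (hf : ∀ n, Integrable (fun ω => f n ω ^ 2) P)
    (hsum : Summable fun n => ∫ ω, f n ω ^ 2 ∂P) :
    ∀ᵐ ω ∂P, Tendsto (fun n => f n ω) atTop (𝓝 0) := by
  have hmeas : ∀ n, AEMeasurable (fun ω => ENNReal.ofReal (f n ω ^ 2)) P :=
    fun n => (hf n).aemeasurable.ennreal_ofReal
  have hfinite : ∫⁻ ω, ∑' n, ENNReal.ofReal (f n ω ^ 2) ∂P ≠ ⊤ := by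
    simp_rw [lintegral_tsum hmeas,
      ← fun n => ofReal_integral_eq_lintegral_ofReal (hf n) (.of_forall fun _ => sq_nonneg _)]
    exact hsum.tsum_ofReal_ne_top
  filter_upwards [ae_lt_top' (.tsum hmeas) hfinite] with ω hω
  have hsq : Tendsto (fun n => f n ω ^ 2) atTop (𝓝 0) := by
    simpa [ENNReal.toReal_ofReal, sq_nonneg] using
      (ENNReal.summable_toReal hω.ne).tendsto_atTop_zero
  simpa [tendsto_zero_iff_abs_tendsto_zero, Real.sqrt_sq_eq_abs, Function.comp_def] using hsq.sqrt

theorem eventually_succ_sq_le_mul_sq {a : ℝ} (ha : 1 < a) :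
    ∀ᶠ n : ℕ in atTop, (((n + 1) ^ 2 : ℕ) : ℝ) ≤ a * (n ^ 2 : ℕ) := by
  filter_upwards [eventually_ge_atTop 1, eventually_ge_atTop ⌈3 / (a - 1)⌉₊] with n h₁ hn
  have h₁' : (1 : ℝ) ≤ n := by exact_mod_cast h₁
  have hn' : 3 ≤ (a - 1) * n := (div_le_iff₀' (sub_pos.2 ha)).1 (Nat.ceil_le.1 hn)
  push_cast
  nlinarith

theorem tendsto_div_of_monotone_of_tendsto_div_sq {u : ℕ → ℝ} {l : ℝ} (hu : Monotone u)
    (hsq : Tendsto (fun n : ℕ => u (n ^ 2) / (n : ℝ) ^ 2) atTop (𝓝 l)) :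
    Tendsto (fun n : ℕ => u n / n) atTop (𝓝 l) :=
  tendsto_div_of_monotone_of_exists_subseq_tendsto_div u l hu fun _ ha =>
    ⟨fun n => n ^ 2, eventually_succ_sq_le_mul_sq ha, tendsto_pow_atTop two_ne_zero,
      by simpa only [Nat.cast_pow] using hsq⟩

theorem condExp_sub_indicator_sq [IsFiniteMeasure P] {m : MeasurableSpace Ω} (hm : m ≤ mΩ)
    {X : Ω → ℝ} (hX : StronglyMeasurable[m] X) (hX2 : MemLp X 2 P) {D : Set Ω}
    (hD : MeasurableSet[mΩ] D) :
    P[fun ω => (X ω - D.indicator (fun _ => 1) ω) ^ 2 | m] =ᵐ[P]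
      fun ω => X ω ^ 2 - (2 * X ω - 1) * (P⟦D | m⟧) ω := by
  let f : Ω → ℝ := fun ω => 2 * X ω - 1
  have hf : StronglyMeasurable[m] f := (hX.const_mul 2).sub stronglyMeasurable_const
  have hfi : Integrable f P := ((hX2.integrable one_le_two).const_mul 2).sub (integrable_const 1)
  have hfD : Integrable (f * D.indicator fun _ => 1) P := by
    have hmul : (f * D.indicator fun _ => 1) = D.indicator f := by
      ext ω
      by_cases hω : ω ∈ D <;> simp [hω]
    exact hmul ▸ hfi.indicator hD
  have hexpand : (fun ω => (X ω - D.indicator (fun _ => 1) ω) ^ 2) =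
      (fun ω => X ω ^ 2) - f * D.indicator fun _ => 1 := by
    ext ω
    by_cases hω : ω ∈ D <;> simp [f, hω]
    ring
  rw [hexpand]
  filter_upwards [condExp_sub (m := m) hX2.integrable_sq hfD,
    condExp_mul_of_stronglyMeasurable_left hf hfD ((integrable_const (1 : ℝ)).indicator hD)]
    with ω hsub hpull
  rw [hsub, Pi.sub_apply, hpull, Pi.mul_apply,
    condExp_of_stronglyMeasurable (f := fun ω => X ω ^ 2) hm (hX.pow 2) hX2.integrable_sq]

theorem condProb_mem_Icc [IsFiniteMeasure P] {m : MeasurableSpace Ω} {D : Set Ω} (hm : m ≤ mΩ)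
    (hD : MeasurableSet[mΩ] D) : ∀ᵐ ω ∂P, (P⟦D | m⟧) ω ∈ Set.Icc (0 : ℝ) 1 := by
  have hle := condExp_mono (m := m) (μ := P) ((integrable_const (1 : ℝ)).indicator hD)
    (integrable_const (1 : ℝ)) (.of_forall fun ω => Set.indicator_le_self' (by simp) ω)
  have hnonneg : 0 ≤ᵐ[P] P⟦D | m⟧ :=
    condExp_nonneg (.of_forall fun ω => Set.indicator_nonneg (by simp) ω)
  rw [condExp_const hm] at hle
  filter_upwards [hle, hnonneg] with ω h₁ h₀ using ⟨h₀, h₁⟩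

theorem sq_sub_two_mul_le {w b t : ℝ} (ht : 1 ≤ t) (hπ : b + w / t ∈ Set.Icc (0 : ℝ) 1) :
    (w + b) ^ 2 - (2 * (w + b) - 1) * (b + w / t) ≤ w ^ 2 + 1 := by
  have hcontract : (w - w / t) ^ 2 ≤ w ^ 2 := by
    have hfactor : w - w / t = w * (1 - t⁻¹) := by ring
    rw [hfactor, mul_pow]
    refine mul_le_of_le_one_right (sq_nonneg w) (pow_le_one₀ ?_ ?_)
    · exact sub_nonneg.2 (inv_le_one_of_one_le₀ ht)
    · exact sub_le_self 1 (by positivity)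
  obtain ⟨h₀, h₁⟩ := hπ
  nlinarith

/-- The drift hypothesis makes the step from `W` to `W + b - 𝟙_D` contract `W` in mean by the factor
`1 - 1 / T`, so that only the Bernoulli variance is added to the second moment. -/
theorem integral_sq_add_sub_indicator_le [IsFiniteMeasure P] {m : MeasurableSpace Ω} (hm : m ≤ mΩ)
    {W T : Ω → ℝ} {b : ℝ} {D : Set Ω} (hW : StronglyMeasurable[m] W) (hW2 : MemLp W 2 P)
    (hD : MeasurableSet[mΩ] D) (hT : ∀ ω, 1 ≤ T ω)
    (hdrift : P⟦D | m⟧ =ᵐ[P] fun ω => b + W ω / T ω) :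
    ∫ ω, (W ω + b - D.indicator (fun _ => 1) ω) ^ 2 ∂P ≤ ∫ ω, W ω ^ 2 ∂P + P.real Set.univ := by
  calc ∫ ω, (W ω + b - D.indicator (fun _ => 1) ω) ^ 2 ∂P
      = ∫ ω, (P[fun ω => (W ω + b - D.indicator (fun _ => 1) ω) ^ 2 | m]) ω ∂P :=
        (integral_condExp hm).symm
    _ ≤ ∫ ω, (W ω ^ 2 + 1) ∂P := by
        refine integral_mono_ae integrable_condExp
          (hW2.integrable_sq.add (integrable_const 1)) ?_
        filter_upwards [hdrift, condProb_mem_Icc hm hD, condExp_sub_indicator_sq hm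
          (hW.add stronglyMeasurable_const) (hW2.add (memLp_const b)) hD] with ω hω hmem hcond
        rw [hω] at hmem
        exact (hcond.trans (by rw [hω]; rfl)).trans_le (sq_sub_two_mul_le (hT ω) hmem)
    _ = ∫ ω, W ω ^ 2 ∂P + P.real Set.univ := by
        simp [integral_add hW2.integrable_sq]

/-- The deviation `w₀ + n b - N n` of the number `N n` of the events `D 0, …, D (n - 1)` that occur
from linear growth at rate `b`; the offset `w₀` leaves room for the initial state of an urn. -/
noncomputable def countDeviation (D : ℕ → Set Ω) (b w₀ : ℝ) : ℕ → Ω → ℝ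
  | 0, _ => w₀
  | n + 1, ω => countDeviation D b w₀ n ω + b - (D n).indicator (fun _ => 1) ω

open scoped Classical in
theorem countDeviation_eq (D : ℕ → Set Ω) (b w₀ : ℝ) (n : ℕ) (ω : Ω) :
    countDeviation D b w₀ n ω = w₀ + n * b - Nat.count (fun t => ω ∈ D t) n := by
  induction n with
  | zero => simp [countDeviation]
  | succ n ih =>
    rw [countDeviation, ih, Nat.count_succ, Set.indicator_apply]
    push_cast
    ring

section Filtration

variable {ℱ : Filtration ℕ mΩ} {D : ℕ → Set Ω}

theorem stronglyMeasurable_countDeviation (hD : ∀ n, MeasurableSet[ℱ (n + 1)] (D n)) (b w₀ : ℝ)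
    (n : ℕ) : StronglyMeasurable[ℱ n] (countDeviation D b w₀ n) := by
  induction n with
  | zero => exact stronglyMeasurable_const
  | succ n ih =>
    exact ((ih.mono (ℱ.mono n.le_succ)).add stronglyMeasurable_const).sub
      (stronglyMeasurable_const.indicator (hD n))

variable [IsFiniteMeasure P]

theorem memLp_countDeviation (hD : ∀ n, MeasurableSet[mΩ] (D n)) (b w₀ : ℝ) (n : ℕ) :
    MemLp (countDeviation D b w₀ n) 2 P := by
  induction n with
  | zero => exact memLp_const w₀
  | succ n ih => exact (ih.add (memLp_const b)).sub ((memLp_const 1).indicator (hD n))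

variable {T : ℕ → Ω → ℝ} {b w₀ : ℝ}

theorem integral_countDeviation_sq_le (hD : ∀ n, MeasurableSet[ℱ (n + 1)] (D n))
    (hT : ∀ n ω, 1 ≤ T n ω)
    (hdrift : ∀ n, P⟦D n | ℱ n⟧ =ᵐ[P] fun ω => b + countDeviation D b w₀ n ω / T n ω) (n : ℕ) :
    ∫ ω, countDeviation D b w₀ n ω ^ 2 ∂P ≤ (w₀ ^ 2 + n) * P.real Set.univ := by
  induction n with
  | zero => simp [countDeviation, mul_comm]
  | succ n ih =>
    have hstep := integral_sq_add_sub_indicator_le (ℱ.le n)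
      (stronglyMeasurable_countDeviation hD b w₀ n)
      (memLp_countDeviation (fun t => ℱ.le _ _ (hD t)) b w₀ n) (ℱ.le _ _ (hD n)) (hT n) (hdrift n)
    simp only [countDeviation]
    push_cast
    linarith

theorem ae_tendsto_countDeviation_div_sq (hD : ∀ n, MeasurableSet[ℱ (n + 1)] (D n))
    (hT : ∀ n ω, 1 ≤ T n ω)
    (hdrift : ∀ n, P⟦D n | ℱ n⟧ =ᵐ[P] fun ω => b + countDeviation D b w₀ n ω / T n ω) :
    ∀ᵐ ω ∂P, Tendsto (fun n : ℕ => countDeviation D b w₀ (n ^ 2) ω / (n : ℝ) ^ 2) atTop (𝓝 0) := by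
  have hL2 := memLp_countDeviation (P := P) (fun t => ℱ.le _ _ (hD t)) b w₀
  refine ae_tendsto_zero_of_summable_integral_sq
    (fun n => ((hL2 (n ^ 2)).mul_const ((n : ℝ) ^ 2)⁻¹).integrable_sq) ?_
  refine .of_nonneg_of_le (fun n => integral_nonneg fun ω => sq_nonneg _) (fun n => ?_)
    ((Real.summable_one_div_nat_pow.2 one_lt_two).mul_left ((w₀ ^ 2 + 1) * P.real Set.univ))
  rcases n.eq_zero_or_pos with rfl | hn
  · simp
  have hn1 : (1 : ℝ) ≤ n := by exact_mod_cast hn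
  have hsq := integral_countDeviation_sq_le hD hT hdrift (n ^ 2)
  have hlin : w₀ ^ 2 + ((n ^ 2 : ℕ) : ℝ) ≤ (w₀ ^ 2 + 1) * (n : ℝ) ^ 2 := by
    push_cast
    nlinarith [one_le_pow₀ hn1 (n := 2), sq_nonneg w₀]
  calc ∫ ω, (countDeviation D b w₀ (n ^ 2) ω / (n : ℝ) ^ 2) ^ 2 ∂P
      = (∫ ω, countDeviation D b w₀ (n ^ 2) ω ^ 2 ∂P) / (n : ℝ) ^ 4 := by
        simp_rw [div_pow, integral_div, ← pow_mul]
    _ ≤ (w₀ ^ 2 + 1) * (n : ℝ) ^ 2 * P.real Set.univ / (n : ℝ) ^ 4 := by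
        gcongr
        exact hsq.trans (by gcongr)
    _ = (w₀ ^ 2 + 1) * P.real Set.univ * (1 / (n : ℝ) ^ 2) := by
        field_simp

open scoped Classical in
theorem ae_tendsto_count_div_of_condProb (hD : ∀ n, MeasurableSet[ℱ (n + 1)] (D n))
    (hT : ∀ n ω, 1 ≤ T n ω)
    (hdrift : ∀ n, P⟦D n | ℱ n⟧ =ᵐ[P] fun ω => b + countDeviation D b w₀ n ω / T n ω) :
    ∀ᵐ ω ∂P, Tendsto (fun n : ℕ => (Nat.count (fun t => ω ∈ D t) n : ℝ) / n) atTop (𝓝 b) := by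
  filter_upwards [ae_tendsto_countDeviation_div_sq hD hT hdrift] with ω hω
  refine tendsto_div_of_monotone_of_tendsto_div_sq
    (u := fun n => (Nat.count (fun t => ω ∈ D t) n : ℝ))
    (Nat.mono_cast.comp (Nat.count_monotone _)) ?_
  have hinv : Tendsto (fun n : ℕ => w₀ / (n : ℝ) ^ 2) atTop (𝓝 0) :=
    tendsto_const_nhds.div_atTop
      ((tendsto_pow_atTop two_ne_zero).comp tendsto_natCast_atTop_atTop)
  have hlim := (hinv.add_const b).sub hω
  rw [zero_add, sub_zero] at hlim
  refine hlim.congr' ?_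
  filter_upwards [eventually_ne_atTop 0] with n hn
  rw [countDeviation_eq]
  push_cast
  field_simp
  ring

end Filtration

end StrongLaw

section History

open scoped ProbabilityTheory

variable {Ω X Y : Type*}

theorem ae_measure_preimage_singleton_ne_zero [Countable Y] {_ : MeasurableSpace Ω} (P : Measure Ω)
    (H : Ω → Y) : ∀ᵐ ω ∂P, P (H ⁻¹' {H ω}) ≠ 0 := by
  have hnull : P (⋃ y : {y // P (H ⁻¹' {y}) = 0}, H ⁻¹' {y.1}) = 0 :=
    measure_iUnion_null fun y => y.2
  refine measure_mono_null (fun ω hω => Set.mem_iUnion.2 ⟨⟨H ω, ?_⟩, rfl⟩) hnull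
  simpa using hω

theorem condProb_comap_ae_eq_cond {mΩ : MeasurableSpace Ω} [MeasurableSpace Y]
    [MeasurableSingletonClass Y] [Countable Y] {P : Measure Ω} [IsFiniteMeasure P] {H : Ω → Y}
    (hH : Measurable H) {A : Set Ω} (hA : MeasurableSet A) :
    P⟦A | MeasurableSpace.comap H inferInstance⟧ =ᵐ[P] fun ω => (P[|H ⁻¹' {H ω}]).real A := by
  have hpre : (· ∈ A) ⁻¹' {True} = A := by ext; simp
  have hcond := ProbabilityTheory.condDistrib_ae_eq_condExp (μ := P) hH hA.mem
    (measurableSet_singleton True)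
  rw [hpre] at hcond
  filter_upwards [hcond, ae_measure_preimage_singleton_ne_zero P H] with ω hω hne
  have hmap : P.map H {H ω} = P (H ⁻¹' {H ω}) := Measure.map_apply hH (measurableSet_singleton _)
  rw [← hω, Measure.real, Measure.real, ProbabilityTheory.condDistrib_apply_of_ne_zero hA.mem _
    (hmap ▸ hne), hmap, Measure.map_apply (hH.prodMk hA.mem) (by measurability),
    ProbabilityTheory.cond_apply (hH (measurableSet_singleton _)), Set.mk_preimage_prod, hpre]

theorem preimage_singleton_past (L : ℕ → Ω → X) (n : ℕ) (ω : Ω) :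
    (fun ω (t : Set.Iio n) => L t ω) ⁻¹' {fun t : Set.Iio n => L t ω} =
      {ω' | ∀ t < n, L t ω' = L t ω} := by
  ext ω'
  simp [funext_iff]

variable {mΩ : MeasurableSpace Ω} [MeasurableSpace X]

/-- The filtration of a process up to but excluding the present: at time `n` it knows the values at
the times before `n`. -/
def pastFiltration (L : ℕ → Ω → X) (hL : ∀ n, Measurable (L n)) : Filtration ℕ mΩ where
  seq n := ⨆ t < n, MeasurableSpace.comap (L t) inferInstance
  mono' _ _ hn := biSup_mono fun _ ht => lt_of_lt_of_le ht hn
  le' _ := iSup₂_le fun t _ => (hL t).comap_le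

variable {L : ℕ → Ω → X} (hL : ∀ n, Measurable (L n)) (n : ℕ)

theorem pastFiltration_eq_comap : pastFiltration L hL n =
    MeasurableSpace.comap (fun ω (t : Set.Iio n) => L t ω) inferInstance := by
  rw [MeasurableSpace.comap_process_pi, iSup_subtype]
  rfl

theorem measurable_pastFiltration_succ : Measurable[pastFiltration L hL (n + 1)] (L n) :=
  measurable_iff_comap_le.2 (le_iSup₂_of_le n n.lt_succ_self le_rfl)

end History

namespace HookingNetwork

section Combinatorics

variable {V E : Type*} {S : Graph V E} {hook : V} {q : ℕ → ℕ × V} {n : ℕ}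

/-- The nodes of the network at age `n` with their labels: the vertices of the seed, and the
vertices other than the hook of each of the copies `1, …, n`. The network has exactly these nodes
provided that every latch is a node of the network from which it is chosen. -/
def nodes (S : Graph V E) (hook : V) (n : ℕ) : Set (ℕ × V) :=
  {0} ×ˢ V(S) ∪ Set.Icc 1 n ×ˢ (V(S) \ {hook})

theorem fst_le_of_mem_nodes {x : ℕ × V} (hx : x ∈ nodes S hook n) : x.1 ≤ n := by
  rcases hx with ⟨h, -⟩ | ⟨h, -⟩
  · exact h.trans_le n.zero_le
  · exact h.2

theorem nodes_mono (S : Graph V E) (hook : V) : Monotone (nodes S hook) := fun _ _ h =>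
  Set.union_subset_union_right _ (Set.prod_mono (Set.Icc_subset_Icc_right h) subset_rfl)

theorem nodes_finite [Finite V] (S : Graph V E) (hook : V) (n : ℕ) : (nodes S hook n).Finite :=
  ((Set.finite_Iic n).prod Set.finite_univ).subset fun _ hx => ⟨fst_le_of_mem_nodes hx, trivial⟩

theorem ncard_nodes_inter_preimage_snd [Finite V] (S : Graph V E) (hook : V) (n : ℕ) (U : Set V) :
    (nodes S hook n ∩ Prod.snd ⁻¹' U).ncard =
      (V(S) ∩ U).ncard + n * ((V(S) ∩ U) \ {hook}).ncard := by
  have hprod : nodes S hook n ∩ Prod.snd ⁻¹' U =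
      {0} ×ˢ (V(S) ∩ U) ∪ Set.Icc 1 n ×ˢ ((V(S) ∩ U) \ {hook}) := by
    ext x
    simp only [nodes, Set.mem_inter_iff, Set.mem_union, Set.mem_prod, Set.mem_preimage,
      Set.mem_sdiff]
    tauto
  have hdisj : Disjoint ({0} : Set ℕ) (Set.Icc 1 n) := by simp
  rw [hprod, Set.ncard_union_eq (Set.Disjoint.set_prod_left hdisj _ _), Set.ncard_prod,
    Set.ncard_prod]
  simp

theorem place_eq_self {x : ℕ × V} (hx : x ∈ nodes S hook n) : place hook q x.1 x.2 = x := by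
  obtain ⟨t, v⟩ := x
  rcases t with _ | t
  · rfl
  · have hv : v ≠ hook := by simpa [nodes] using fun h => hx.resolve_left (by simp) |>.2.2 h
    simp [place, hv]

theorem place_mem_nodes {t : ℕ} (h : ∀ s < t, q s ∈ nodes S hook s) {v : V} (hv : v ∈ V(S)) :
    place hook q t v ∈ nodes S hook t := by
  rcases t with _ | t
  · exact .inl ⟨rfl, hv⟩
  · rw [place]
    split_ifs with hvh
    · exact nodes_mono S hook t.le_succ (h t t.lt_succ_self)
    · exact .inr ⟨⟨t.succ_pos, le_rfl⟩, hv, hvh⟩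

theorem vertexSet_network (h : ∀ t < n, q t ∈ nodes S hook t) :
    V(network S hook q n) = nodes S hook n := by
  refine Set.Subset.antisymm ?_ fun x hx => ⟨x.1, fst_le_of_mem_nodes hx, x.2, ?_, ?_⟩
  · rintro _ ⟨t, ht, v, hv, rfl⟩
    exact nodes_mono S hook ht (place_mem_nodes (fun s hs => h s (hs.trans_le ht)) hv)
  · exact hx.elim And.right fun hx => hx.2.1
  · exact (place_eq_self hx).symm

/-- A latch is older than the copy hooked to it, so up to the age at which a node appears only its
own copy has a vertex placed at it. -/
theorem place_eq_iff (h : ∀ t, q t ∈ nodes S hook t) {x : ℕ × V} (hx : x ∈ nodes S hook n)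
    {s : ℕ} (hs : s ≤ x.1) {u : V} : place hook q s u = x ↔ (s, u) = x := by
  refine ⟨fun hp => ?_, fun hp => hp ▸ place_eq_self (hp ▸ hx)⟩
  rcases s with _ | s
  · exact hp
  · rw [place] at hp
    split_ifs at hp with hu
    · exact absurd (fst_le_of_mem_nodes (h s)) (by rw [hp]; omega)
    · exact hp

theorem incidenceSet_network (h : ∀ t, q t ∈ nodes S hook t) {x : ℕ × V}
    (hx : x ∈ nodes S hook n) :
    (network S hook q x.1).incidenceSet x = Prod.mk x.1 '' S.incidenceSet x.2 := by
  ext ⟨s, f⟩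
  constructor
  · rintro ⟨y, hs, u, v, huv, hu, -⟩
    obtain rfl := (place_eq_iff h hx hs).1 hu.symm
    exact ⟨f, ⟨v, huv⟩, rfl⟩
  · rintro ⟨f', ⟨v, hv⟩, heq⟩
    obtain ⟨rfl, rfl⟩ := Prod.mk.inj heq
    exact ⟨_, le_rfl, x.2, v, hv, (place_eq_self hx).symm, rfl⟩

theorem loopSet_network (h : ∀ t, q t ∈ nodes S hook t) {x : ℕ × V} (hx : x ∈ nodes S hook n) :
    (network S hook q x.1).loopSet x = Prod.mk x.1 '' S.loopSet x.2 := by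
  ext ⟨s, f⟩
  constructor
  · rintro ⟨hs, u, v, huv, hu, hv⟩
    obtain rfl := (place_eq_iff h hx hs).1 hu.symm
    obtain rfl := (Prod.mk.inj ((place_eq_iff h hx hs).1 hv.symm)).2
    exact ⟨f, huv, rfl⟩
  · rintro ⟨f', hf, heq⟩
    obtain ⟨rfl, rfl⟩ := Prod.mk.inj heq
    exact ⟨le_rfl, x.2, x.2, hf, (place_eq_self hx).symm, (place_eq_self hx).symm⟩

theorem originalDegree_eq (h : ∀ t, q t ∈ nodes S hook t) {x : ℕ × V} (hx : x ∈ nodes S hook n) :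
    originalDegree S hook q x = degree S x.2 := by
  rw [originalDegree, degree, degree, incidenceSet_network h hx, loopSet_network h hx,
    Set.ncard_image_of_injective _ (Prod.mk_right_injective _),
    Set.ncard_image_of_injective _ (Prod.mk_right_injective _)]

theorem latchCount_eq_zero_iff {x : ℕ × V} : latchCount q n x = 0 ↔ x ∉ q '' Set.Iio n := by
  rw [latchCount, Set.ncard_eq_zero ((Set.finite_Iio n).subset fun _ ht => ht.1),
    Set.eq_empty_iff_forall_notMem]
  simp

theorem latchCount_eq_one_iff (hq : Function.Injective q) {x : ℕ × V} :
    latchCount q n x = 1 ↔ x ∈ q '' Set.Iio n := by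
  refine ⟨fun hx => not_not.1 fun hx' => ?_, ?_⟩
  · exact one_ne_zero (hx.symm.trans (latchCount_eq_zero_iff.2 hx'))
  · rintro ⟨t, ht, rfl⟩
    refine Set.ncard_eq_one.2 ⟨t, Set.ext fun s => ?_⟩
    simpa [hq.eq_iff] using! fun h : s = t => h ▸ ht

/-- The nodes at age `n` that have not been latches, hence those that carry the insertion positions
of the unary network. -/
def freeNodes (S : Graph V E) (hook : V) (q : ℕ → ℕ × V) (n : ℕ) : Set (ℕ × V) :=
  nodes S hook n \ q '' Set.Iio n

theorem freeNodes_finite [Finite V] : (freeNodes S hook q n).Finite :=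
  (nodes_finite S hook n).sdiff

theorem insertionPositions_one (h : ∀ t < n, q t ∈ nodes S hook t) :
    insertionPositions S hook 1 q n = (·, 0) '' freeNodes S hook q n := by
  ext ⟨x, c⟩
  simp only [insertionPositions, freeNodes, vertexSet_network h, Set.mem_ofPred_eq, Set.mem_image,
    Prod.mk.injEq, Set.mem_sdiff]
  constructor
  · rintro ⟨hx, hc⟩
    exact ⟨x, ⟨hx, latchCount_eq_zero_iff.1 (by omega)⟩, rfl, by omega⟩
  · rintro ⟨_, ⟨hx, hx'⟩, rfl, rfl⟩
    exact ⟨hx, by simp [latchCount_eq_zero_iff.2 hx']⟩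

/-- The infinite sequence `q` chooses the latches of a unary network: each of them is a node of the
network from which it is chosen, and no node is chosen twice. -/
structure IsLatchSeq (S : Graph V E) (hook : V) (q : ℕ → ℕ × V) : Prop where
  mem_nodes : ∀ t, q t ∈ nodes S hook t
  injective : Function.Injective q

theorem isLatchSeq_of_forall_mem_insertionPositions
    (h : ∀ n, ∃ c, (q n, c) ∈ insertionPositions S hook 1 q n) : IsLatchSeq S hook q := by
  have hfree : ∀ n, q n ∈ freeNodes S hook q n := fun n => by
    induction n using Nat.strong_induction_on with
    | _ n ih =>
      obtain ⟨c, hc⟩ := h n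
      rw [insertionPositions_one fun t ht => (ih t ht).1] at hc
      obtain ⟨x, hx, hxq⟩ := hc
      exact (Prod.mk.inj hxq).1 ▸ hx
  exact ⟨fun t => (hfree t).1,
    Function.Injective.of_lt_imp_ne fun s t hst heq => (hfree t).2 ⟨s, hst, heq⟩⟩

namespace IsLatchSeq

variable (hq : IsLatchSeq S hook q)
include hq

theorem ncard_image_Iio_inter_preimage_snd (U : Set V) [DecidablePred (· ∈ U)] :
    (q '' Set.Iio n ∩ Prod.snd ⁻¹' U).ncard = Nat.count (fun t => (q t).2 ∈ U) n := by
  rw [← Set.image_inter_preimage, Set.ncard_image_of_injective _ hq.injective,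
    Nat.count_eq_card_filter_range, ← Set.ncard_coe_finset]
  congr 1
  ext t
  simp

theorem image_Iio_subset_nodes : q '' Set.Iio n ⊆ nodes S hook n := by
  rintro _ ⟨t, ht, rfl⟩
  exact nodes_mono S hook (Set.mem_Iio.1 ht).le (hq.mem_nodes t)

theorem ncard_freeNodes_inter_add_count [Finite V] (U : Set V) [DecidablePred (· ∈ U)] :
    (freeNodes S hook q n ∩ Prod.snd ⁻¹' U).ncard + Nat.count (fun t => (q t).2 ∈ U) n =
      (V(S) ∩ U).ncard + n * ((V(S) ∩ U) \ {hook}).ncard := by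
  rw [← hq.ncard_image_Iio_inter_preimage_snd, ← ncard_nodes_inter_preimage_snd, freeNodes,
    Set.inter_sdiff_distrib_right]
  exact Set.ncard_sdiff_add_ncard_of_subset
    (Set.inter_subset_inter_left _ hq.image_Iio_subset_nodes)
    ((nodes_finite S hook n).inter_of_left _)

theorem ncard_freeNodes [Finite V] (hhook : hook ∈ V(S)) :
    ((freeNodes S hook q n).ncard : ℝ) = V(S).ncard + n * ((V(S).ncard : ℝ) - 2) := by
  have hsum := hq.ncard_freeNodes_inter_add_count (n := n) Set.univ
  have hcopy := Set.ncard_sdiff_singleton_add_one hhook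
  simp only [Set.preimage_univ, Set.inter_univ, Set.mem_univ, Nat.count_true] at hsum
  rify at hsum hcopy
  linear_combination hsum + n * hcopy

theorem nodeCount_zero (δ : ℕ) : nodeCount S hook q n δ 0 =
    (freeNodes S hook q n ∩ Prod.snd ⁻¹' {v | degree S v = δ}).ncard := by
  rw [nodeCount, vertexSet_network fun t _ => hq.mem_nodes t]
  congr 1
  ext x
  simp only [freeNodes, latchCount_eq_zero_iff, Set.mem_ofPred_eq, Set.mem_inter_iff, Set.mem_sdiff,
    Set.mem_preimage, and_assoc]
  refine and_congr_right fun hx => ?_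
  rw [originalDegree_eq hq.mem_nodes hx, and_comm]

theorem nodeCount_one (δ : ℕ) : nodeCount S hook q n δ 1 =
    Nat.count (fun t => degree S (q t).2 = δ) n := by
  refine Eq.trans ?_ (hq.ncard_image_Iio_inter_preimage_snd {v | degree S v = δ})
  rw [nodeCount, vertexSet_network fun t _ => hq.mem_nodes t]
  congr 1
  ext x
  simp only [latchCount_eq_one_iff hq.injective, Set.mem_ofPred_eq, Set.mem_inter_iff,
    Set.mem_preimage]
  refine ⟨fun ⟨hx, hdeg, hlatch⟩ => ⟨hlatch, ?_⟩, fun ⟨hlatch, hdeg⟩ => ?_⟩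
  · rwa [← originalDegree_eq hq.mem_nodes hx]
  · have hx := hq.image_Iio_subset_nodes hlatch
    exact ⟨hx, by rwa [originalDegree_eq hq.mem_nodes hx], hlatch⟩

theorem nodeCount_zero_add_nodeCount_one [Finite V] (δ : ℕ) :
    nodeCount S hook q n δ 0 + nodeCount S hook q n δ 1 =
      seedCount S δ + n * ((V(S) ∩ {v | degree S v = δ}) \ {hook}).ncard := by
  rw [hq.nodeCount_zero, hq.nodeCount_one]
  exact hq.ncard_freeNodes_inter_add_count {v | degree S v = δ}

theorem tendsto_nodeCount_zero_div [Finite V] {δ : ℕ} {l : ℝ}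
    (h : Tendsto (fun n => (nodeCount S hook q n δ 1 : ℝ) / n) atTop (𝓝 l)) :
    Tendsto (fun n => (nodeCount S hook q n δ 0 : ℝ) / n) atTop
      (𝓝 (((V(S) ∩ {v | degree S v = δ}) \ {hook}).ncard - l)) := by
  have hseed := tendsto_const_div_atTop_nhds_zero_nat (seedCount S δ : ℝ)
  have hlim := (hseed.add_const (((V(S) ∩ {v | degree S v = δ}) \ {hook}).ncard : ℝ)).sub h
  rw [zero_add] at hlim
  refine hlim.congr' ?_
  filter_upwards [eventually_ne_atTop 0] with n hn
  have hsum := congrArg (Nat.cast (R := ℝ)) (hq.nodeCount_zero_add_nodeCount_one (n := n) δ)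
  push_cast at hsum
  field_simp
  linarith

end IsLatchSeq

theorem ncard_inter_degree_sdiff_hook [Finite V] (hhook : hook ∈ V(S)) (δ : ℕ) :
    (((V(S) ∩ {v | degree S v = δ}) \ {hook}).ncard : ℝ) =
      seedCount S δ - if δ = degree S hook then 1 else 0 := by
  rw [seedCount]
  split_ifs with hδ
  · have hmem : hook ∈ V(S) ∩ {v | degree S v = δ} := ⟨hhook, hδ.symm⟩
    rw [eq_sub_iff_add_eq]
    exact_mod_cast Set.ncard_sdiff_singleton_add_one hmem
  · rw [sub_zero, Set.sdiff_singleton_eq_self fun h => hδ h.2.symm]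
    rfl

end Combinatorics

end HookingNetwork

theorem uniformOn_apply_eq_ncard_div {X : Type*} [MeasurableSpace X] [MeasurableSingletonClass X]
    {s : Set X} (hs : s.Finite) (t : Set X) :
    ProbabilityTheory.uniformOn s t = (s ∩ t).ncard / s.ncard := by
  have hcount : ∀ u : Set X, u.Finite → Measure.count u = (u.ncard : ENNReal) := fun u hu => by
    rw [Measure.count_apply_finite u hu, Set.ncard_eq_toFinset_card u hu]
  rw [ProbabilityTheory.uniformOn, ProbabilityTheory.cond_apply hs.measurableSet, hcount s hs,
    hcount _ (hs.inter_of_left t), ENNReal.div_eq_inv_mul]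

namespace HookingNetwork

section UniformHooking

open scoped ProbabilityTheory

variable {V E : Type*} {S : Graph V E} {hook : V} {m : ℕ} {Ω : Type*}
  [MeasurableSpace Ω] {P : Measure Ω} {L : ℕ → Ω → ℕ × V}

namespace IsUniformHooking

theorem measurableSet_past (hL : IsUniformHooking S hook m P L) (n : ℕ) (q : ℕ → ℕ × V) :
    MeasurableSet {ω | ∀ t < n, L t ω = q t} := by
  simp only [Set.ofPred_forall]
  exact .iInter fun t => .iInter fun _ => hL.measurable t (q t)

variable [Finite V]

theorem ae_exists_mem_insertionPositions [IsFiniteMeasure P]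
    (hL : IsUniformHooking S hook m P L) :
    ∀ᵐ ω ∂P, ∀ n, ∃ c, (L n ω, c) ∈ insertionPositions S hook m (fun t => L t ω) n := by
  have hpos : ∀ᵐ ω ∂P, ∀ n, P {ω' | ∀ t < n, L t ω' = L t ω} ≠ 0 := ae_all_iff.2 fun n => by
    filter_upwards [ae_measure_preimage_singleton_ne_zero P fun ω (t : Set.Iio n) => L t ω]
      with ω hω
    rwa [← preimage_singleton_past]
  filter_upwards [hpos] with ω hω n
  have hinter : {ω' | ∀ t < n, L t ω' = L t ω} ∩ {ω' | L n ω' = L n ω} =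
      {ω' | ∀ t < n + 1, L t ω' = L t ω} := by
    ext ω'
    simp [Nat.forall_lt_succ_right, -Order.lt_add_one_iff]
  have hcond := ProbabilityTheory.cond_pos_of_inter_ne_zero
    (hL.measurableSet_past n fun t => L t ω) (hinter ▸ hω (n + 1))
  rw [hL.uniform n (fun t => L t ω) (L n ω) (hω n)] at hcond
  have hncard := (ENNReal.div_pos_iff.1 hcond).1
  obtain ⟨⟨x, c⟩, hc, rfl⟩ := Set.nonempty_of_ncard_ne_zero (Nat.cast_ne_zero.1 hncard)
  exact ⟨c, hc⟩

theorem ae_isLatchSeq [IsFiniteMeasure P] (hL : IsUniformHooking S hook 1 P L) :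
    ∀ᵐ ω ∂P, IsLatchSeq S hook fun t => L t ω :=
  hL.ae_exists_mem_insertionPositions.mono fun _ =>
    isLatchSeq_of_forall_mem_insertionPositions

section Measurable

variable [MeasurableSpace V]

theorem measurable_latch (hL : IsUniformHooking S hook m P L) (n : ℕ) : Measurable (L n) :=
  measurable_to_countable' (hL.measurable n)

variable [MeasurableSingletonClass V]

theorem map_cond (hL : IsUniformHooking S hook 1 P L) {n : ℕ} {q : ℕ → ℕ × V}
    (hq : ∀ t < n, q t ∈ nodes S hook t) (hpos : P {ω | ∀ t < n, L t ω = q t} ≠ 0) :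
    (P[|{ω | ∀ t < n, L t ω = q t}]).map (L n) =
      ProbabilityTheory.uniformOn (freeNodes S hook q n) := by
  refine Measure.ext_of_singleton fun x => ?_
  have hat : {p ∈ insertionPositions S hook 1 q n | p.1 = x} =
      (·, 0) '' (freeNodes S hook q n ∩ {x}) := by
    rw [insertionPositions_one hq]
    exact (Set.image_inter_preimage (·, 0) (freeNodes S hook q n) {p | p.1 = x}).symm
  have hinj : Function.Injective fun x : ℕ × V => (x, 0) := Prod.mk_left_injective 0
  rw [Measure.map_apply (hL.measurable_latch n) (measurableSet_singleton x),
    uniformOn_apply_eq_ncard_div freeNodes_finite]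
  refine (hL.uniform n q x hpos).trans ?_
  rw [hat, insertionPositions_one hq, Set.ncard_image_of_injective _ hinj,
    Set.ncard_image_of_injective _ hinj]

theorem condProb_latch [IsFiniteMeasure P] (hL : IsUniformHooking S hook 1 P L) (n : ℕ)
    (A : Set (ℕ × V)) :
    P⟦L n ⁻¹' A | pastFiltration L hL.measurable_latch n⟧ =ᵐ[P] fun ω =>
      ((freeNodes S hook (fun t => L t ω) n ∩ A).ncard : ℝ) /
        (freeNodes S hook (fun t => L t ω) n).ncard := by
  rw [pastFiltration_eq_comap]
  have hpast : Measurable fun ω (t : Set.Iio n) => L t ω :=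
    measurable_pi_lambda _ fun t => hL.measurable_latch t
  have hA : MeasurableSet A := A.to_countable.measurableSet
  filter_upwards [condProb_comap_ae_eq_cond hpast (hL.measurable_latch n hA), hL.ae_isLatchSeq,
    ae_measure_preimage_singleton_ne_zero P fun ω (t : Set.Iio n) => L t ω] with ω hω hq hpos
  rw [preimage_singleton_past] at hω hpos
  rw [hω, Measure.real, ← Measure.map_apply (hL.measurable_latch n) hA,
    hL.map_cond (fun t _ => hq.mem_nodes t) hpos,
    uniformOn_apply_eq_ncard_div freeNodes_finite]
  simp

open scoped Classical in
/-- The number of free positions at copies of vertices in `U` is `b` times the number of all free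
positions, plus the deviation of the number of latches in `U` from linear growth at rate `b`. -/
theorem condProb_latch_snd_mem [IsFiniteMeasure P] (hL : IsUniformHooking S hook 1 P L)
    (hsize : 2 ≤ V(S).ncard) (hhook : hook ∈ V(S)) (U : Set V) {b : ℝ}
    (hb : b = ((V(S) ∩ U) \ {hook}).ncard / ((V(S).ncard : ℝ) - 1)) (n : ℕ) :
    P⟦L n ⁻¹' (Prod.snd ⁻¹' U) | pastFiltration L hL.measurable_latch n⟧ =ᵐ[P] fun ω =>
      b + countDeviation (fun n => L n ⁻¹' (Prod.snd ⁻¹' U)) b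
        ((V(S) ∩ U).ncard - b * V(S).ncard) n ω / (V(S).ncard + n * ((V(S).ncard : ℝ) - 2)) := by
  filter_upwards [hL.condProb_latch n (Prod.snd ⁻¹' U), hL.ae_isLatchSeq] with ω hω hq
  have hτ : (2 : ℝ) ≤ V(S).ncard := by exact_mod_cast hsize
  have hT : (V(S).ncard + n * ((V(S).ncard : ℝ) - 2)) ≠ 0 := by
    have := sub_nonneg.2 hτ
    positivity
  have hcopy : b * ((V(S).ncard : ℝ) - 1) = ((V(S) ∩ U) \ {hook}).ncard :=
    hb ▸ div_mul_cancel₀ _ (by linarith)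
  have hfree := hq.ncard_freeNodes_inter_add_count (n := n) U
  rify at hfree
  rw [hω, hq.ncard_freeNodes hhook, countDeviation_eq, div_eq_iff hT, add_mul, div_mul_cancel₀ _ hT]
  simp only [Set.mem_preimage]
  linear_combination hfree - n * hcopy

theorem ae_tendsto_count_div [IsFiniteMeasure P] (hL : IsUniformHooking S hook 1 P L)
    (hsize : 2 ≤ V(S).ncard) (hhook : hook ∈ V(S)) (U : Set V) [DecidablePred (· ∈ U)] :
    ∀ᵐ ω ∂P, Tendsto (fun n : ℕ => (Nat.count (fun t => (L t ω).2 ∈ U) n : ℝ) / n) atTop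
      (𝓝 (((V(S) ∩ U) \ {hook}).ncard / ((V(S).ncard : ℝ) - 1))) := by
  have hτ : (2 : ℝ) ≤ V(S).ncard := by exact_mod_cast hsize
  have hT (n : ℕ) : (1 : ℝ) ≤ V(S).ncard + n * ((V(S).ncard : ℝ) - 2) := by
    nlinarith [n.cast_nonneg (α := ℝ)]
  convert ae_tendsto_count_div_of_condProb
    (D := fun n => L n ⁻¹' (Prod.snd ⁻¹' U)) (ℱ := pastFiltration L hL.measurable_latch)
    (T := fun n _ => V(S).ncard + n * ((V(S).ncard : ℝ) - 2))
    (fun n => measurable_pastFiltration_succ _ n (Set.to_countable _).measurableSet)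
    (fun n _ => hT n) (hL.condProb_latch_snd_mem hsize hhook U rfl)
  rfl

end Measurable

theorem ae_tendsto_nodeCount_one_div [IsFiniteMeasure P] (hL : IsUniformHooking S hook 1 P L)
    (hsize : 2 ≤ V(S).ncard) (hhook : hook ∈ V(S)) (δ : ℕ) :
    ∀ᵐ ω ∂P, Tendsto (fun n => (nodeCount S hook (fun t => L t ω) n δ 1 : ℝ) / n) atTop
      (𝓝 (((V(S) ∩ {v | degree S v = δ}) \ {hook}).ncard / ((V(S).ncard : ℝ) - 1))) := by
  let _ : MeasurableSpace V := ⊤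
  filter_upwards [hL.ae_isLatchSeq, hL.ae_tendsto_count_div hsize hhook {v | degree S v = δ}]
    with ω hq hcount
  simpa only [hq.nodeCount_one] using hcount

end IsUniformHooking

end UniformHooking

end HookingNetwork

theorem corollary1_general {V E : Type*} [Finite V] [Finite E] (S : Graph V E)
    (hsize : 2 ≤ V(S).ncard) (hook : V) (hhook : hook ∈ V(S)) {Ω : Type*} [MeasurableSpace Ω]
    (P : Measure Ω) [IsFiniteMeasure P] (L : ℕ → Ω → ℕ × V)
    (hL : HookingNetwork.IsUniformHooking S hook 1 P L) :
    ∀ᵐ ω ∂P, ∀ (δ : ℕ) (s : Fin 2), Tendsto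
      (fun n : ℕ => (1 / (n : ℝ)) * (HookingNetwork.nodeCount S hook (fun t => L t ω) n δ s : ℝ))
      atTop
      (𝓝 ((1 / ((V(S).ncard : ℝ) - 1)) * ((if s = 0 then (V(S).ncard : ℝ) - 2 else 1) *
        ((HookingNetwork.seedCount S δ : ℝ) -
          if δ = HookingNetwork.degree S hook then 1 else 0)))) := by
  have hτ : (V(S).ncard : ℝ) - 1 ≠ 0 := by
    rify at hsize
    linarith
  filter_upwards [hL.ae_isLatchSeq,
    ae_all_iff.2 (hL.ae_tendsto_nodeCount_one_div hsize hhook)] with ω hq hone δ s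
  rw [← HookingNetwork.ncard_inter_degree_sdiff_hook hhook]
  simp only [one_div_mul_eq_div]
  match s with
  | 0 =>
    have hlimit (B τ : ℝ) (hτ : τ - 1 ≠ 0) : B - B / (τ - 1) = (τ - 2) * B / (τ - 1) := by
      field_simp
      ring
    simpa [hlimit _ _ hτ] using hq.tendsto_nodeCount_zero_div (hone δ)
  | 1 => simpa using hone δ

theorem corollary1 {V E : Type*} [Finite V] [Finite E]
    (S : Graph V E) (hconn : HookingNetwork.Connected S) (hsize : 2 ≤ V(S).ncard)
    (hook : V) (hhook : hook ∈ V(S))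
    (k : ℕ) (d : Fin k → ℕ) (hd : StrictMono d)
    (hdeg : Set.range d = HookingNetwork.degree S '' V(S))
    (i : Fin k) (hi : d i = HookingNetwork.degree S hook)
    (hnondeg : HookingNetwork.Nondegenerate 1
      (fun j : Fin k => HookingNetwork.seedCount S (d j)) i)
    {Ω : Type*} [MeasurableSpace Ω] (P : Measure Ω) [IsProbabilityMeasure P]
    (L : ℕ → Ω → ℕ × V) (hL : HookingNetwork.IsUniformHooking S hook 1 P L) :
    ∀ᵐ ω ∂P, Tendsto
      (fun n : ℕ => fun c : Fin 2 × Fin k =>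
        (1 / (n : ℝ)) *
          (HookingNetwork.nodeCount S hook (fun t => L t ω) n (d c.2) (c.1 : ℕ) : ℝ))
      atTop
      (𝓝 (fun c : Fin 2 × Fin k =>
        (1 / ((V(S).ncard : ℝ) - 1)) *
          ((if c.1 = 0 then (V(S).ncard : ℝ) - 2 else 1) *
            ((HookingNetwork.seedCount S (d c.2) : ℝ) - if c.2 = i then 1 else 0)))) := by
  filter_upwards [corollary1_general S hsize hook hhook P L hL] with ω hω
  exact tendsto_pi_nhds.2 fun c => by simpa [← hi, hd.injective.eq_iff] using hω (d c.2) c.1
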